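/- Let $K$ be a number field and $n\ge 2$ an integer. For an integer $H\ge 1$ let $\mathcal B_n(H)$ be the set of monic polynomials $x^n+a_{n-1}x^{n-1}+\dots+a_0\in\mathbb Z[x]$ with $\max_{0\le i\le n-1}|a_i|\le H$, and let $M_K(H)\subseteq\mathcal B_n(H)$ be the subset of polynomials having at least one root in $K$. Let $\mathrm{red}_n(H)$ and $\mathrm{irr}_n(H)$ be the sets of those $P\in M_K(H)$ that are reducible, respectively irreducible, over $\mathbb Q$. Then the proportion $\#M_K(H)/\#\mathcal B_n(H)$ tends to $0$ as $H\to\infty$, and, with implied constants that may depend on $n$ and $K$ but not on $H$: 1. If $n=2$, then $\dfrac{\#M_K(H)}{\#\mathcal B_n(H)}=O(H^{-1}\log H)$ for $H\ge 2$; if $n\ge 3$, then $\dfrac{\#M_K(H)}{\#\mathcal B_n(H)}=O(H^{-1})$ for $H\ge 1$. 2. If $n=2$, then $\#\mathrm{red}_n(H)=O(H\log H)$ for $H\ge 2$; if $n\ge 3$, then $\#\mathrm{red}_n(H)=O(H^{n-1})$ for $H\ge 1$. 3. $\#\mathrm{irr}_n(H)=O\big(H(\log H)^{n-1}\big)$ for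 $H\ge 2$. 4. If $n\ge 3$, the contribution of the irreducible polynomials is negligible compared to that of the reducible ones: $\#\mathrm{irr}_n(H)=o\big(\#\mathrm{red}_n(H)\big)$ as $H\to\infty$. -/

import Mathlib

open Polynomial

noncomputable section

/-- The set of monic integer polynomials of degree `n`. -/
def MonicIntPoly (n : ℕ) : Set ℤ[X] :=
  {P | P.Monic ∧ P.natDegree = n}

/-- The height of a monic polynomial: the maximum of the absolute values of its
non-leading coefficients. -/
def monicHeight (P : ℤ[X]) : ℕ :=
  (Finset.range P.natDegree).sup fun i => (P.coeff i).natAbs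

/-- The box of monic integer polynomials of degree `n` and height at most `H`. -/
def polyBox (n H : ℕ) : Set ℤ[X] :=
  {P | P ∈ MonicIntPoly n ∧ monicHeight P ≤ H}

/-- The box is finite, so cardinalities of its subsets are honest natural numbers. -/
theorem polyBox_finite (n H : ℕ) : (polyBox n H).Finite := by
  have hfin : (Set.Icc (fun _ : Fin n => -(H : ℤ)) (fun _ => (H : ℤ))).Finite :=
    Set.finite_Icc _ _
  refine Set.Finite.of_finite_image
    (f := fun (P : ℤ[X]) (i : Fin n) => P.coeff i) (hfin.subset ?_) ?_
  · rintro _ ⟨P, ⟨⟨_, hdeg⟩, hH⟩, rfl⟩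
    have key : ∀ i : Fin n, |P.coeff i| ≤ (H : ℤ) := by
      intro i
      have h := (Finset.sup_le_iff.mp hH) (i : ℕ) (by rw [hdeg]; simp)
      rw [Int.abs_eq_natAbs]
      exact_mod_cast h
    exact ⟨fun i => (abs_le.mp (key i)).1, fun i => (abs_le.mp (key i)).2⟩
  · rintro P ⟨⟨hP, hPd⟩, _⟩ Q ⟨⟨hQ, hQd⟩, _⟩ h
    ext i
    rcases lt_trichotomy i n with hi | hi | hi
    · exact congrFun h ⟨i, hi⟩
    · have h1 : P.coeff i = 1 := by rw [hi, ← hPd]; exact hP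
      have h2 : Q.coeff i = 1 := by rw [hi, ← hQd]; exact hQ
      rw [h1, h2]
    · rw [coeff_eq_zero_of_natDegree_lt (by omega), coeff_eq_zero_of_natDegree_lt (by omega)]

/-- The number of elements of `S` in the box of height `H`. -/
def boxCount (S : Set ℤ[X]) (n H : ℕ) : ℕ :=
  (S ∩ polyBox n H).ncard

/-- The proportion of elements of the box of height `H` that lie in `S`. -/
def boxDensity (S : Set ℤ[X]) (n H : ℕ) : ℝ :=
  (boxCount S n H : ℝ) / ((polyBox n H).ncard : ℝ)

/-- The monic integer polynomials of degree `n` with at least one root in `K`. -/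
def rootFamily (K : Type*) [Field K] (n : ℕ) : Set ℤ[X] :=
  {P | P ∈ MonicIntPoly n ∧ ∃ α : K, aeval α P = 0}

/-- The members of the family that are irreducible over `ℚ`. -/
def irrFamily (K : Type*) [Field K] (n : ℕ) : Set ℤ[X] :=
  {P | P ∈ rootFamily K n ∧ Irreducible (P.map (Int.castRingHom ℚ))}

/-- The members of the family that are reducible over `ℚ` (used for degree `n ≥ 2`). -/
def redFamily (K : Type*) [Field K] (n : ℕ) : Set ℤ[X] :=
  {P | P ∈ rootFamily K n ∧ ¬ Irreducible (P.map (Int.castRingHom ℚ))}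

end

/-!
The Mahler measure `M` is multiplicative, and on monic integer polynomials of degree `n` it is
comparable, up to constants depending on `n`, with the height (`intMahler_le_of_mem_polyBox`,
`natAbs_coeff_le_intMahler`).

*Reducible polynomials.* By Gauss's lemma such a polynomial is `Q * R` with `Q`, `R` monic over `ℤ`
and `1 ≤ k = deg Q ≤ n / 2`, and the heights of `Q` and `R` have product at most `T = O(H)`
(`redFamily_subset`). Given `Q` of height `h` there are `O((T / h) ^ (n - k))` choices of `R`.
The sum over `Q` is estimated by a product of one-dimensional sums (`card_heightProducts_le`),
using `h ^ (n - k) ≥ ∏ (max 1 |z i|) ^ e` for the coefficients `z i` of `Q` and `k * e ≤ n - k`. For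
`n ≥ 3` and `k = 1` the choice `e = 2` gives a convergent sum; in all other cases `e = 1` costs a
factor `(log T) ^ k`, which is harmless when `k ≥ 2` because a power of `T` is saved. In the opposite
direction, the multiples of `X` give at least `H ^ (n - 1)` reducible polynomials
(`le_boxCount_redFamily`).

*Irreducible polynomials.* A root `α` in `K` generates one of the finitely many subfields `F` of `K`
of degree `n`, and `M(P)` is the product of `max 1 |σ α|` over the embeddings `σ : F → ℂ`
(`prod_max_one_norm_le_intMahler`). Rounding `Re (σ α) + Im (σ α)` for all `σ` maps the algebraic
integers of `F` to integer vectors of length `n`. The fibres are bounded, because there are finitely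
many algebraic integers with bounded conjugates (`exists_embVec_fiber_bound`), and the image of the
roots lies in a region `∏ max 1 |z σ| ≤ O(H)`, which contains `O(H (log H) ^ (n - 1))` integer
vectors (`hyperbolic_count`).
-/

/-! ### Boxes of polynomials and boxes of integer vectors -/

theorem mem_polyBox_iff {n H : ℕ} {P : ℤ[X]} :
    P ∈ polyBox n H ↔ P.Monic ∧ P.natDegree = n ∧ ∀ i < n, (P.coeff i).natAbs ≤ H := by
  constructor
  · rintro ⟨⟨hm, hd⟩, hH⟩
    refine ⟨hm, hd, fun i hi => ?_⟩
    exact (Finset.sup_le_iff.mp hH) i (by simpa [hd] using hi)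
  · rintro ⟨hm, hd, h⟩
    refine ⟨⟨hm, hd⟩, Finset.sup_le fun i hi => h i ?_⟩
    simpa [hd] using hi

/-- The integer vectors of length `n` with all entries of absolute value at most `H`. -/
noncomputable def vecBox (n H : ℕ) : Finset (Fin n → ℤ) :=
  Fintype.piFinset fun _ => Finset.Icc (-(H : ℤ)) H

theorem mem_vecBox {n H : ℕ} {z : Fin n → ℤ} : z ∈ vecBox n H ↔ ∀ i, (z i).natAbs ≤ H := by
  simp only [vecBox, Fintype.mem_piFinset, Finset.mem_Icc]
  exact forall_congr' fun i => by omega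

theorem card_vecBox (n H : ℕ) : (vecBox n H).card = (2 * H + 1) ^ n := by
  simp only [vecBox, Fintype.card_piFinset, Int.card_Icc, Finset.prod_const, Finset.card_univ,
    Fintype.card_fin]
  congr 1
  omega

/-- The monic polynomial of degree `n` with prescribed lower coefficients. -/
noncomputable def monicOfVec {n : ℕ} (z : Fin n → ℤ) : ℤ[X] :=
  X ^ n + ∑ i : Fin n, C (z i) * X ^ (i : ℕ)

theorem degree_sum_vec_lt {n : ℕ} (z : Fin n → ℤ) :
    (∑ i : Fin n, C (z i) * X ^ (i : ℕ)).degree < (n : WithBot ℕ) := by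
  refine (Polynomial.degree_sum_le _ _).trans_lt ?_
  rw [Finset.sup_lt_iff (by exact WithBot.bot_lt_coe n)]
  exact fun i _ => (degree_C_mul_X_pow_le _ _).trans_lt (by exact_mod_cast i.2)

theorem monicOfVec_monic {n : ℕ} (z : Fin n → ℤ) : (monicOfVec z).Monic :=
  monic_X_pow_add (degree_sum_vec_lt z)

theorem natDegree_monicOfVec {n : ℕ} (z : Fin n → ℤ) : (monicOfVec z).natDegree = n := by
  rw [monicOfVec, natDegree_add_eq_left_of_degree_lt, natDegree_X_pow]
  rw [degree_X_pow]
  exact degree_sum_vec_lt z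

theorem coeff_monicOfVec {n : ℕ} (z : Fin n → ℤ) (i : Fin n) :
    (monicOfVec z).coeff i = z i := by
  simp [monicOfVec, coeff_X_pow, i.2.ne, Fin.val_inj]

theorem monicOfVec_injective (n : ℕ) :
    Function.Injective (monicOfVec : (Fin n → ℤ) → ℤ[X]) := fun z w h => by
  funext i
  rw [← coeff_monicOfVec z i, h, coeff_monicOfVec]

theorem monicOfVec_coeff {n : ℕ} {P : ℤ[X]} (hm : P.Monic) (hd : P.natDegree = n) :
    monicOfVec (fun i : Fin n => P.coeff i) = P := by
  ext i
  rcases lt_trichotomy i n with hi | rfl | hi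
  · exact coeff_monicOfVec (fun i : Fin n => P.coeff i) ⟨i, hi⟩
  · have h1 := monicOfVec_monic (fun j : Fin i => P.coeff j)
    rw [Monic, leadingCoeff, natDegree_monicOfVec] at h1
    rw [h1, ← hm.coeff_natDegree, hd]
  · rw [coeff_eq_zero_of_natDegree_lt (by rwa [natDegree_monicOfVec]),
      coeff_eq_zero_of_natDegree_lt (by omega)]

theorem polyBox_eq_image (n H : ℕ) : polyBox n H = monicOfVec '' (vecBox n H : Set (Fin n → ℤ)) := by
  ext P
  rw [mem_polyBox_iff]
  constructor
  · rintro ⟨hm, hd, h⟩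
    exact ⟨fun i => P.coeff i, mem_vecBox.2 fun i => h i i.2, monicOfVec_coeff hm hd⟩
  · rintro ⟨z, hz, rfl⟩
    refine ⟨monicOfVec_monic z, natDegree_monicOfVec z, fun i hi => ?_⟩
    rw [coeff_monicOfVec z ⟨i, hi⟩]
    exact mem_vecBox.1 hz _

theorem ncard_polyBox (n H : ℕ) : (polyBox n H).ncard = (2 * H + 1) ^ n := by
  rw [polyBox_eq_image, Set.ncard_image_of_injective _ (monicOfVec_injective n),
    Set.ncard_coe_finset, card_vecBox]

/-! ### Height and Mahler measure -/

/-- The Mahler measure of an integer polynomial. -/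
noncomputable def intMahler (P : ℤ[X]) : ℝ := (P.map (Int.castRingHom ℂ)).mahlerMeasure

theorem intMahler_mul (P Q : ℤ[X]) : intMahler (P * Q) = intMahler P * intMahler Q := by
  simp [intMahler, mahlerMeasure_mul]

theorem one_le_intMahler {P : ℤ[X]} (hP : P.Monic) : 1 ≤ intMahler P :=
  one_le_mahlerMeasure_of_ne_zero hP.ne_zero

theorem intMahler_le_of_mem_polyBox {n H : ℕ} (hH : 1 ≤ H) {P : ℤ[X]} (hP : P ∈ polyBox n H) :
    intMahler P ≤ (n + 1) * H := by
  obtain ⟨hm, hd, h⟩ := mem_polyBox_iff.1 hP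
  refine (mahlerMeasure_le_sum_norm_coeff _).trans ?_
  rw [sum_over_range' _ (by simp) (n + 1) (by rw [hm.natDegree_map, hd]; omega)]
  refine (Finset.sum_le_card_nsmul _ _ (H : ℝ) fun i hi => ?_).trans (by simp)
  rw [coeff_map]
  have hi' : i ≤ n := by simpa [Nat.lt_succ_iff] using hi
  have : (P.coeff i).natAbs ≤ H := by
    rcases hi'.lt_or_eq with h1 | rfl
    · exact h i h1
    · rw [← hd, hm.coeff_natDegree]; simpa using hH
  simp only [eq_intCast, Complex.norm_intCast]
  rw [← Int.cast_abs, Int.abs_eq_natAbs]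
  exact_mod_cast this

theorem natAbs_coeff_le_intMahler {n : ℕ} {P : ℤ[X]} (hm : P.Monic) (hd : P.natDegree = n)
    (i : ℕ) : ((P.coeff i).natAbs : ℝ) ≤ 2 ^ n * intMahler P := by
  have h := norm_coeff_le_choose_mul_mahlerMeasure i (P.map (Int.castRingHom ℂ))
  rw [hm.natDegree_map, hd, coeff_map, eq_intCast, Complex.norm_intCast, ← Int.cast_abs,
    Int.abs_eq_natAbs] at h
  have h2 : ((n.choose i : ℕ) : ℝ) ≤ 2 ^ n := by exact_mod_cast Nat.choose_le_two_pow n i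
  rw [Int.cast_natCast] at h
  refine h.trans (mul_le_mul_of_nonneg_right h2 ?_)
  exact zero_le_one.trans (one_le_intMahler hm)

/-! ### Sums and counts over integer vectors -/

/-- The height `max 1 |z|` of an integer. -/
def intHt (z : ℤ) : ℕ := max 1 z.natAbs

theorem one_le_intHt (z : ℤ) : 1 ≤ intHt z := le_max_left _ _

theorem natAbs_le_intHt (z : ℤ) : z.natAbs ≤ intHt z := le_max_right _ _

theorem sum_Icc_natAbs (f : ℕ → ℝ) (T : ℕ) :
    ∑ z ∈ Finset.Icc (-(T : ℤ)) T, f z.natAbs = f 0 + 2 * ∑ k ∈ Finset.Icc 1 T, f k := by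
  induction T with
  | zero => simp
  | succ T ih =>
    have h : Finset.Icc (-((T + 1 : ℕ) : ℤ)) ((T + 1 : ℕ) : ℤ) =
        insert (-((T + 1 : ℕ) : ℤ)) (insert ((T + 1 : ℕ) : ℤ) (Finset.Icc (-(T : ℤ)) T)) := by
      ext z; simp only [Finset.mem_insert, Finset.mem_Icc]; omega
    rw [h, Finset.sum_insert (by simp only [Finset.mem_insert, Finset.mem_Icc]; omega),
      Finset.sum_insert (by simp only [Finset.mem_Icc]; omega), ih,
      Finset.sum_Icc_succ_top (by omega), Int.natAbs_neg, Int.natAbs_natCast]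
    ring

theorem sum_inv_intHt_pow (e T : ℕ) :
    ∑ z ∈ Finset.Icc (-(T : ℤ)) T, ((intHt z : ℝ) ^ e)⁻¹ =
      1 + 2 * ∑ k ∈ Finset.Icc 1 T, ((k : ℝ) ^ e)⁻¹ := by
  refine (sum_Icc_natAbs (fun k : ℕ => (((max 1 k : ℕ) : ℝ) ^ e)⁻¹) T).trans ?_
  congr 1
  · simp
  · congr 1
    refine Finset.sum_congr rfl fun k hk => ?_
    rw [max_eq_right (Finset.mem_Icc.1 hk).1]

theorem sum_inv_intHt_le (T : ℕ) :
    ∑ z ∈ Finset.Icc (-(T : ℤ)) T, ((intHt z : ℝ))⁻¹ ≤ 3 * (1 + Real.log T) := by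
  have h := sum_inv_intHt_pow 1 T
  simp only [pow_one] at h
  rw [h]
  have h2 := harmonic_le_one_add_log T
  rw [harmonic_eq_sum_Icc] at h2
  push_cast at h2
  have h3 : 0 ≤ Real.log T := Real.log_natCast_nonneg T
  linarith

theorem sum_inv_intHt_sq_le (T : ℕ) :
    ∑ z ∈ Finset.Icc (-(T : ℤ)) T, ((intHt z : ℝ) ^ 2)⁻¹ ≤ 5 := by
  rw [sum_inv_intHt_pow]
  -- telescoping: `1 / k ^ 2 ≤ 1 / (k - 1 / 2) - 1 / (k + 1 / 2)`
  have h : ∀ T : ℕ, ∑ k ∈ Finset.Icc 1 T, ((k : ℝ) ^ 2)⁻¹ ≤ 2 - 2 / (2 * T + 1) := by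
    intro T
    induction T with
    | zero => simp
    | succ T ih =>
      rw [Finset.sum_Icc_succ_top (by omega)]
      have : (((T + 1 : ℕ) : ℝ) ^ 2)⁻¹ ≤ 2 / (2 * T + 1) - 2 / (2 * (T + 1 : ℕ) + 1) := by
        push_cast
        rw [div_sub_div _ _ (by positivity) (by positivity), ← one_div,
          div_le_div_iff₀ (by positivity) (by positivity)]
        nlinarith
      linarith
  have := h T
  have h0 : (0 : ℝ) ≤ 2 / (2 * T + 1) := by positivity
  linarith

/-- The number of integer vectors of length `m + 1` in the hyperbolic region
`∏ max 1 |z i| ≤ T` is `O(T (log T) ^ m)`. -/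
theorem hyperbolic_count (m : ℕ) : ∀ T : ℕ, 1 ≤ T →
    {z : Fin (m + 1) → ℤ | ∏ i, intHt (z i) ≤ T}.Finite ∧
    ({z : Fin (m + 1) → ℤ | ∏ i, intHt (z i) ≤ T}.ncard : ℝ) ≤
      3 ^ (m + 1) * T * (1 + Real.log T) ^ m := by
  induction m with
  | zero =>
    intro T hT
    have hsub : {z : Fin (0 + 1) → ℤ | ∏ i, intHt (z i) ≤ T} ⊆ (vecBox 1 T : Set (Fin 1 → ℤ)) := by
      intro z hz
      refine Finset.mem_coe.2 (mem_vecBox.2 fun i => ?_)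
      have : intHt (z 0) ≤ T := by simpa using hz
      rw [Subsingleton.elim i 0]
      exact (natAbs_le_intHt _).trans this
    refine ⟨(Finset.finite_toSet _).subset hsub, ?_⟩
    have h := Set.ncard_le_ncard hsub (Finset.finite_toSet _)
    rw [Set.ncard_coe_finset, card_vecBox, pow_one] at h
    have h' : {z : Fin (0 + 1) → ℤ | ∏ i, intHt (z i) ≤ T}.ncard ≤ 3 * T := h.trans (by omega)
    simpa using (show ({z : Fin (0 + 1) → ℤ | ∏ i, intHt (z i) ≤ T}.ncard : ℝ) ≤ 3 * T by
      exact_mod_cast h')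
  | succ m ih =>
    intro T hT
    -- slice by the first entry `a`: the remaining entries satisfy the bound `T / max 1 |a|`
    let S : ℤ → Set (Fin (m + 1 + 1) → ℤ) := fun a =>
      (fun w : Fin (m + 1) → ℤ => (Fin.cons a w : Fin (m + 1 + 1) → ℤ)) ''
        {w | ∏ i, intHt (w i) ≤ T / intHt a}
    have hht : ∀ a ∈ Finset.Icc (-(T : ℤ)) T, 1 ≤ T / intHt a := fun a ha => by
      rw [Nat.one_le_div_iff (one_le_intHt a)]
      rw [Finset.mem_Icc] at ha
      exact max_le hT (by omega)
    have hsub : {z : Fin (m + 1 + 1) → ℤ | ∏ i, intHt (z i) ≤ T} ⊆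
        ⋃ a ∈ Finset.Icc (-(T : ℤ)) T, S a := by
      intro z hz
      rw [Set.mem_ofPred_eq, Fin.prod_univ_succ] at hz
      have hp : 1 ≤ ∏ i : Fin (m + 1), intHt (z i.succ) :=
        Finset.one_le_prod' fun i _ => one_le_intHt _
      have h0 : (z 0).natAbs ≤ T :=
        (natAbs_le_intHt _).trans ((Nat.le_mul_of_pos_right _ hp).trans hz)
      refine Set.mem_biUnion (x := z 0) (by simp only [Finset.mem_coe, Finset.mem_Icc]; omega)
        ⟨fun i => z i.succ, ?_, Fin.cons_self_tail z⟩
      rw [Set.mem_ofPred_eq, Nat.le_div_iff_mul_le (one_le_intHt _), mul_comm]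
      exact hz
    have hSfin : ∀ a ∈ Finset.Icc (-(T : ℤ)) T, (S a).Finite := fun a ha =>
      (ih _ (hht a ha)).1.image _
    have hUfin : (⋃ a ∈ Finset.Icc (-(T : ℤ)) T, S a).Finite :=
      (Finset.finite_toSet _).biUnion hSfin
    refine ⟨hUfin.subset hsub, ?_⟩
    have hl : 0 ≤ Real.log T := Real.log_natCast_nonneg T
    have hS : ∀ a ∈ Finset.Icc (-(T : ℤ)) T, ((S a).ncard : ℝ) ≤
        3 ^ (m + 1) * T * (1 + Real.log T) ^ m * (intHt a : ℝ)⁻¹ := by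
      intro a ha
      have ha0 : (0 : ℝ) < intHt a := by exact_mod_cast one_le_intHt a
      have h1 : ((S a).ncard : ℝ) ≤ _ :=
        le_trans (by exact_mod_cast Set.ncard_image_le (ih _ (hht a ha)).1) (ih _ (hht a ha)).2
      have h2 : ((T / intHt a : ℕ) : ℝ) ≤ T * (intHt a : ℝ)⁻¹ := by
        rw [← div_eq_mul_inv]; exact Nat.cast_div_le
      have h3 : Real.log ((T / intHt a : ℕ) : ℝ) ≤ Real.log T :=
        Real.log_le_log (by exact_mod_cast hht a ha) (by exact_mod_cast Nat.div_le_self _ _)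
      have h4 : 0 ≤ Real.log ((T / intHt a : ℕ) : ℝ) := Real.log_natCast_nonneg _
      calc _ ≤ _ := h1
        _ ≤ 3 ^ (m + 1) * (T * (intHt a : ℝ)⁻¹) * (1 + Real.log T) ^ m := by gcongr
        _ = _ := by ring
    calc ({z : Fin (m + 1 + 1) → ℤ | ∏ i, intHt (z i) ≤ T}.ncard : ℝ)
        ≤ ((⋃ a ∈ Finset.Icc (-(T : ℤ)) T, S a).ncard : ℝ) := by
          exact_mod_cast Set.ncard_le_ncard hsub hUfin
      _ ≤ ∑ a ∈ Finset.Icc (-(T : ℤ)) T, ((S a).ncard : ℝ) := by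
          exact_mod_cast Finset.set_ncard_biUnion_le _ _
      _ ≤ ∑ a ∈ Finset.Icc (-(T : ℤ)) T,
          3 ^ (m + 1) * T * (1 + Real.log T) ^ m * (intHt a : ℝ)⁻¹ := Finset.sum_le_sum hS
      _ = 3 ^ (m + 1) * T * (1 + Real.log T) ^ m *
          ∑ a ∈ Finset.Icc (-(T : ℤ)) T, (intHt a : ℝ)⁻¹ := by rw [Finset.mul_sum]
      _ ≤ 3 ^ (m + 1) * T * (1 + Real.log T) ^ m * (3 * (1 + Real.log T)) := by
          gcongr; exact sum_inv_intHt_le T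
      _ = _ := by ring

/-- Powers of the logarithm are dominated by a linear function, uniformly on `x ≥ 1`. -/
theorem one_add_log_pow_le (k : ℕ) {x : ℝ} (hx : 1 ≤ x) :
    (1 + Real.log x) ^ k ≤ k.factorial * Real.exp 1 * x := by
  have h := Real.pow_div_factorial_le_exp (1 + Real.log x)
    (by linarith [Real.log_nonneg hx]) k
  rw [Real.exp_add, Real.exp_log (by linarith), div_le_iff₀ (by positivity)] at h
  linarith

theorem one_add_log_mul_le {c x : ℝ} (hc : 1 ≤ c) (hx : 1 ≤ x) :
    1 + Real.log (c * x) ≤ (1 + Real.log c) * (1 + Real.log x) := by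
  rw [Real.log_mul (by linarith) (by linarith)]
  nlinarith [mul_nonneg (Real.log_nonneg hc) (Real.log_nonneg hx)]

/-! ### Reducible polynomials -/

/-- By Gauss's lemma, a monic integer polynomial that is reducible over `ℚ` is a product of two
monic integer polynomials of smaller degree. -/
theorem exists_monic_factorization {n : ℕ} (hn : 2 ≤ n) {P : ℤ[X]} (hm : P.Monic)
    (hd : P.natDegree = n) (hred : ¬ Irreducible (P.map (Int.castRingHom ℚ))) :
    ∃ k ∈ Finset.Icc 1 (n / 2), ∃ Q R : ℤ[X], Q.Monic ∧ R.Monic ∧ Q.natDegree = k ∧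
      R.natDegree = n - k ∧ P = Q * R := by
  have h1 : ¬ Irreducible P := by
    rw [hm.irreducible_iff_irreducible_map_fraction_map (K := ℚ)]
    exact hred
  have hne : P ≠ 1 := by
    rintro rfl
    simp at hd
    omega
  rw [hm.irreducible_iff_natDegree', not_and] at h1
  have h2 := h1 hne
  push Not at h2
  obtain ⟨R, Q, hR, hQ, hRQ, hk⟩ := h2
  rw [hd, Finset.mem_Ioc] at hk
  have hdeg : R.natDegree + Q.natDegree = n := by rw [← hR.natDegree_mul hQ, hRQ, hd]
  exact ⟨Q.natDegree, Finset.mem_Icc.2 hk, Q, R, hQ, hR, rfl, by omega, by rw [← hRQ, mul_comm]⟩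

/-- The height `max 1 (max |z i|)` of an integer vector. -/
def vecHt {n : ℕ} (z : Fin n → ℤ) : ℕ := max 1 (Finset.univ.sup fun i => (z i).natAbs)

theorem one_le_vecHt {n : ℕ} (z : Fin n → ℤ) : 1 ≤ vecHt z := le_max_left _ _

theorem natAbs_le_vecHt {n : ℕ} (z : Fin n → ℤ) (i : Fin n) : (z i).natAbs ≤ vecHt z :=
  (Finset.le_sup (f := fun i => (z i).natAbs) (Finset.mem_univ i)).trans (le_max_right _ _)

theorem intHt_le_vecHt {n : ℕ} (z : Fin n → ℤ) (i : Fin n) : intHt (z i) ≤ vecHt z :=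
  max_le (one_le_vecHt z) (natAbs_le_vecHt z i)

theorem vecHt_le_intMahler {n : ℕ} (z : Fin n → ℤ) :
    (vecHt z : ℝ) ≤ 2 ^ n * intMahler (monicOfVec z) := by
  have hm := monicOfVec_monic z
  have h1 := one_le_intMahler hm
  have h2 : (1 : ℝ) ≤ 2 ^ n := one_le_pow₀ (by norm_num)
  have h0 : (1 : ℝ) ≤ 2 ^ n * intMahler (monicOfVec z) := by nlinarith
  refine (Nat.cast_le.2 (max_le (Nat.le_floor (by simpa using h0))
    (Finset.sup_le fun i _ => Nat.le_floor ?_))).trans (Nat.floor_le (zero_le_one.trans h0))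
  rw [← coeff_monicOfVec z i]
  exact natAbs_coeff_le_intMahler hm (natDegree_monicOfVec z) i

/-- The products of a monic polynomial of degree `k` and a monic polynomial of degree `m`
whose heights have product at most `T`. -/
noncomputable def heightProducts (k m T : ℕ) : Finset ℤ[X] :=
  open Classical in
  (vecBox k T).biUnion fun z =>
    (vecBox m (T / vecHt z)).image fun w => monicOfVec z * monicOfVec w

/-- Multiplicativity of the Mahler measure, compared with the height on both sides, bounds
the product of the heights of the factors. -/
theorem redFamily_subset {K : Type*} [Field K] {n H : ℕ} (hn : 2 ≤ n) (hH : 1 ≤ H) :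
    redFamily K n ∩ polyBox n H ⊆
      ⋃ k ∈ Finset.Icc 1 (n / 2), (heightProducts k (n - k) (2 ^ n * (n + 1) * H) : Set ℤ[X]) := by
  rintro P ⟨⟨-, hred⟩, hbox⟩
  obtain ⟨hm, hd, -⟩ := mem_polyBox_iff.1 hbox
  obtain ⟨k, hk, Q, R, hQ, hR, hQd, hRd, rfl⟩ := exists_monic_factorization hn hm hd hred
  refine Set.mem_biUnion hk ?_
  rw [Finset.mem_Icc] at hk
  obtain ⟨z, rfl⟩ : ∃ z : Fin k → ℤ, monicOfVec z = Q := ⟨_, monicOfVec_coeff hQ hQd⟩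
  obtain ⟨w, rfl⟩ : ∃ w : Fin (n - k) → ℤ, monicOfVec w = R := ⟨_, monicOfVec_coeff hR hRd⟩
  have hprod : vecHt z * vecHt w ≤ 2 ^ n * (n + 1) * H := by
    have h1 := intMahler_le_of_mem_polyBox hH hbox
    rw [intMahler_mul] at h1
    have h2 := vecHt_le_intMahler z
    have h3 := vecHt_le_intMahler w
    have h4 : (vecHt z * vecHt w : ℝ) ≤ 2 ^ n * (n + 1) * H := by
      calc (vecHt z * vecHt w : ℝ) ≤ _ := mul_le_mul h2 h3 (by positivity) (by
            exact (Nat.cast_nonneg _).trans h2)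
        _ = 2 ^ (k + (n - k)) * (intMahler (monicOfVec z) * intMahler (monicOfVec w)) := by
            rw [pow_add]; ring
        _ ≤ 2 ^ n * ((n + 1) * H) := by
            rw [show k + (n - k) = n by omega]
            gcongr
        _ = _ := by ring
    exact_mod_cast h4
  refine Finset.mem_coe.2 (Finset.mem_biUnion.2 ⟨z, mem_vecBox.2 fun i => ?_,
    Finset.mem_image.2 ⟨w, mem_vecBox.2 fun i => ?_, rfl⟩⟩)
  · exact (natAbs_le_vecHt z i).trans ((Nat.le_mul_of_pos_right _ (one_le_vecHt w)).trans hprod)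
  · refine (natAbs_le_vecHt w i).trans ((Nat.le_div_iff_mul_le (one_le_vecHt z)).2 ?_)
    rwa [mul_comm]

/-- For a first factor of height `h` there are at most `(3 T / h) ^ m` second factors.
Since `max 1 (max |z i|) ^ m ≥ ∏ (max 1 |z i|) ^ e` as soon as `k * e ≤ m`, the sum over the
first factor is at most the `k`-th power of a one-dimensional sum. -/
theorem card_heightProducts_le {k m e : ℕ} (hke : k * e ≤ m) {T : ℕ} (hT : 1 ≤ T) :
    ((heightProducts k m T).card : ℝ) ≤
      (3 * T) ^ m * (∑ a ∈ Finset.Icc (-(T : ℤ)) T, ((intHt a : ℝ) ^ e)⁻¹) ^ k := by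
  classical
  have h1 : (heightProducts k m T).card ≤ ∑ z ∈ vecBox k T, (2 * (T / vecHt z) + 1) ^ m := by
    refine Finset.card_biUnion_le.trans (Finset.sum_le_sum fun z _ => ?_)
    exact Finset.card_image_le.trans (card_vecBox _ _).le
  have h2 : ∀ z ∈ vecBox k T, (((2 * (T / vecHt z) + 1) ^ m : ℕ) : ℝ) ≤
      (3 * T) ^ m * ∏ i, ((intHt (z i) : ℝ) ^ e)⁻¹ := by
    intro z hz
    have hv : (1 : ℝ) ≤ vecHt z := by exact_mod_cast one_le_vecHt z
    have hvT : vecHt z ≤ T := max_le hT (Finset.sup_le fun i _ => mem_vecBox.1 hz i)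
    have h3 : ((2 * (T / vecHt z) + 1 : ℕ) : ℝ) ≤ 3 * (T * (vecHt z : ℝ)⁻¹) := by
      have h4 : 1 ≤ T / vecHt z := (Nat.one_le_div_iff (one_le_vecHt z)).2 hvT
      have h5 : ((T / vecHt z : ℕ) : ℝ) ≤ T / vecHt z := Nat.cast_div_le
      rw [div_eq_mul_inv] at h5
      have h6 : (1 : ℝ) ≤ ((T / vecHt z : ℕ) : ℝ) := by exact_mod_cast h4
      push_cast at h5 h6 ⊢
      linarith
    have h7 : ∏ i, (intHt (z i) : ℝ) ^ e ≤ (vecHt z : ℝ) ^ m := by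
      calc ∏ i, (intHt (z i) : ℝ) ^ e ≤ ∏ _i : Fin k, (vecHt z : ℝ) ^ e := by
            gcongr with i
            exact_mod_cast intHt_le_vecHt z i
        _ = (vecHt z : ℝ) ^ (k * e) := by simp [← pow_mul, mul_comm]
        _ ≤ _ := pow_le_pow_right₀ hv hke
    have h8 : 0 < ∏ i, (intHt (z i) : ℝ) ^ e :=
      Finset.prod_pos fun i _ => pow_pos (by exact_mod_cast one_le_intHt _) _
    calc (((2 * (T / vecHt z) + 1) ^ m : ℕ) : ℝ) ≤ (3 * (T * (vecHt z : ℝ)⁻¹)) ^ m := by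
          rw [Nat.cast_pow]; gcongr
      _ = (3 * T) ^ m * ((vecHt z : ℝ) ^ m)⁻¹ := by rw [← mul_assoc, mul_pow, inv_pow]
      _ ≤ (3 * T) ^ m * (∏ i, (intHt (z i) : ℝ) ^ e)⁻¹ := by gcongr
      _ = _ := by rw [Finset.prod_inv_distrib]
  calc ((heightProducts k m T).card : ℝ)
      ≤ ∑ z ∈ vecBox k T, (((2 * (T / vecHt z) + 1) ^ m : ℕ) : ℝ) := by exact_mod_cast h1
    _ ≤ ∑ z ∈ vecBox k T, (3 * T) ^ m * ∏ i, ((intHt (z i) : ℝ) ^ e)⁻¹ := Finset.sum_le_sum h2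
    _ = (3 * T) ^ m * ∏ _i : Fin k, ∑ a ∈ Finset.Icc (-(T : ℤ)) T, ((intHt a : ℝ) ^ e)⁻¹ := by
        rw [← Finset.mul_sum, Finset.prod_univ_sum]; rfl
    _ = _ := by simp

theorem boxCount_redFamily_le_sum {K : Type*} [Field K] {n H : ℕ} (hn : 2 ≤ n) (hH : 1 ≤ H) :
    (boxCount (redFamily K n) n H : ℝ) ≤
      ∑ k ∈ Finset.Icc 1 (n / 2),
        ((heightProducts k (n - k) (2 ^ n * (n + 1) * H)).card : ℝ) := by
  have hfin : (⋃ k ∈ Finset.Icc 1 (n / 2),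
      (heightProducts k (n - k) (2 ^ n * (n + 1) * H) : Set ℤ[X])).Finite :=
    (Finset.finite_toSet _).biUnion fun k _ => Finset.finite_toSet _
  have h := (Set.ncard_le_ncard (redFamily_subset (K := K) hn hH) hfin).trans
    (Finset.set_ncard_biUnion_le _ _)
  simp only [Set.ncard_coe_finset] at h
  exact_mod_cast h

theorem boxCount_redFamily_two (K : Type*) [Field K] : ∃ C : ℝ, 0 < C ∧ ∀ H : ℕ, 1 ≤ H →
    (boxCount (redFamily K 2) 2 H : ℝ) ≤ C * (H * (1 + Real.log H)) := by
  refine ⟨9 * 12 * (1 + Real.log 12), by positivity, fun H hH => ?_⟩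
  have h := boxCount_redFamily_le_sum (K := K) le_rfl hH
  norm_num at h
  have h2 := card_heightProducts_le (k := 1) (m := 1) (e := 1) le_rfl (T := 12 * H) (by omega)
  simp only [pow_one] at h2
  have h3 := sum_inv_intHt_le (12 * H)
  have h4 : 1 + Real.log ((12 * H : ℕ) : ℝ) ≤ (1 + Real.log 12) * (1 + Real.log H) := by
    push_cast
    exact one_add_log_mul_le (by norm_num) (by exact_mod_cast hH)
  calc (boxCount (redFamily K 2) 2 H : ℝ) ≤ _ := Nat.cast_le.2 h
    _ ≤ _ := h2
    _ ≤ (3 * ((12 * H : ℕ) : ℝ)) * (3 * ((1 + Real.log 12) * (1 + Real.log H))) := by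
        gcongr; linarith
    _ = _ := by push_cast; ring

theorem boxCount_redFamily_of_three_le (K : Type*) [Field K] {n : ℕ} (hn : 3 ≤ n) :
    ∃ C : ℝ, 0 < C ∧ ∀ H : ℕ, 1 ≤ H →
      (boxCount (redFamily K n) n H : ℝ) ≤ C * (H : ℝ) ^ (n - 1) := by
  -- a linear factor contributes `O(T ^ (n - 1))` because `∑ 1 / h ^ 2` converges; a factor of
  -- degree `k ≥ 2` contributes `O(T ^ (n - k) (log T) ^ k)`, which loses a power of `T`
  have key : ∀ k ∈ Finset.Icc 1 (n / 2), ∃ C : ℝ, 0 ≤ C ∧ ∀ T : ℕ, 1 ≤ T →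
      ((heightProducts k (n - k) T).card : ℝ) ≤ C * (T : ℝ) ^ (n - 1) := by
    intro k hk
    rw [Finset.mem_Icc] at hk
    rcases hk.1.eq_or_lt with rfl | hk2
    · refine ⟨3 ^ (n - 1) * 5, by positivity, fun T hT => ?_⟩
      refine (card_heightProducts_le (e := 2) (by omega) hT).trans ?_
      rw [pow_one, mul_pow]
      calc _ ≤ 3 ^ (n - 1) * (T : ℝ) ^ (n - 1) * 5 := by
            gcongr; exact sum_inv_intHt_sq_le T
        _ = _ := by ring
    · refine ⟨3 ^ (n - k) * (3 ^ k * (k.factorial * Real.exp 1)), by positivity, fun T hT => ?_⟩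
      refine (card_heightProducts_le (e := 1) (by omega) hT).trans ?_
      have hT' : (1 : ℝ) ≤ T := by exact_mod_cast hT
      simp only [pow_one]
      calc _ ≤ (3 * (T : ℝ)) ^ (n - k) * (3 * (1 + Real.log T)) ^ k := by
            gcongr; exact sum_inv_intHt_le T
        _ = (3 * (T : ℝ)) ^ (n - k) * (3 ^ k * (1 + Real.log T) ^ k) := by
            rw [mul_pow 3 (1 + Real.log (T : ℝ))]
        _ ≤ (3 * (T : ℝ)) ^ (n - k) * (3 ^ k * (k.factorial * Real.exp 1 * T)) := by
            gcongr; exact one_add_log_pow_le k hT'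
        _ = 3 ^ (n - k) * (3 ^ k * (k.factorial * Real.exp 1)) * (T : ℝ) ^ (n - k + 1) := by
            rw [mul_pow]; ring
        _ ≤ _ := by
            gcongr
            omega
  choose! C hC0 hC using key
  refine ⟨(∑ k ∈ Finset.Icc 1 (n / 2), C k + 1) * (2 ^ n * (n + 1)) ^ (n - 1), ?_, fun H hH => ?_⟩
  · have : 0 ≤ ∑ k ∈ Finset.Icc 1 (n / 2), C k := Finset.sum_nonneg hC0
    positivity
  · refine (boxCount_redFamily_le_sum (by omega) hH).trans ?_
    have hT : 1 ≤ 2 ^ n * (n + 1) * H := Nat.succ_le_of_lt (by positivity)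
    calc _ ≤ ∑ k ∈ Finset.Icc 1 (n / 2), C k * ((2 ^ n * (n + 1) * H : ℕ) : ℝ) ^ (n - 1) :=
          Finset.sum_le_sum fun k hk => hC k hk _ hT
      _ = (∑ k ∈ Finset.Icc 1 (n / 2), C k) * ((2 ^ n * (n + 1) * H : ℕ) : ℝ) ^ (n - 1) := by
          rw [Finset.sum_mul]
      _ ≤ (∑ k ∈ Finset.Icc 1 (n / 2), C k + 1) * ((2 ^ n * (n + 1) * H : ℕ) : ℝ) ^ (n - 1) := by
          gcongr; linarith
      _ = _ := by push_cast; rw [mul_pow]; ring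

/-- The multiples of `X` already give `(2 H + 1) ^ (n - 1)` reducible polynomials with a root. -/
theorem le_boxCount_redFamily (K : Type*) [Field K] {n : ℕ} (hn : 2 ≤ n) (H : ℕ) :
    (2 * H + 1) ^ (n - 1) ≤ boxCount (redFamily K n) n H := by
  rw [← ncard_polyBox, boxCount,
    ← Set.ncard_image_of_injective (polyBox (n - 1) H) (mul_right_injective₀ (X_ne_zero (R := ℤ)))]
  refine Set.ncard_le_ncard ?_ ((polyBox_finite n H).inter_of_right _)
  rintro _ ⟨Q, hQ, rfl⟩
  obtain ⟨hm, hd, h⟩ := mem_polyBox_iff.1 hQ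
  have hdeg : (X * Q).natDegree = n := by
    rw [natDegree_X_mul hm.ne_zero, hd]; omega
  refine ⟨⟨⟨⟨monic_X.mul hm, hdeg⟩, 0, by simp⟩, fun hirr => ?_⟩,
    mem_polyBox_iff.2 ⟨monic_X.mul hm, hdeg, fun i hi => ?_⟩⟩
  · rw [Polynomial.map_mul, map_X] at hirr
    rcases hirr.isUnit_or_isUnit rfl with hu | hu
    · exact not_isUnit_X hu
    · have := natDegree_eq_zero_of_isUnit hu
      rw [hm.natDegree_map] at this
      omega
  · rcases i with _ | i
    · simp
    · rw [coeff_X_mul]; exact h i (by omega)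

/-! ### Irreducible polynomials -/

theorem map_eq_minpoly {F : Type*} [Field F] [CharZero F] {P : ℤ[X]} (hm : P.Monic)
    (hirr : Irreducible (P.map (Int.castRingHom ℚ))) {α : F} (hα : aeval α P = 0) :
    P.map (Int.castRingHom ℚ) = minpoly ℚ α := by
  refine minpoly.eq_of_irreducible_of_monic hirr ?_ (hm.map _)
  rw [← algebraMap_int_eq, aeval_map_algebraMap, hα]

section NumberField

variable {F : Type*} [Field F]

/-- An integral coordinate vector of `α`: for each complex embedding `σ`, the integer part of
`Re (σ α) + Im (σ α)`. Together with the conjugate embedding, which gives `Re (σ α) - Im (σ α)`, this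
locates `σ α` up to a bounded error. -/
noncomputable def embVec (α : F) (σ : F →+* ℂ) : ℤ := ⌊(σ α).re + (σ α).im⌋

theorem intHt_embVec_le (α : F) (σ : F →+* ℂ) : (intHt (embVec α σ) : ℝ) ≤ 3 * max 1 ‖σ α‖ := by
  have h1 := abs_le.1 (Complex.abs_re_le_norm (σ α))
  have h2 := abs_le.1 (Complex.abs_im_le_norm (σ α))
  have h3 := Int.floor_le ((σ α).re + (σ α).im)
  have h4 := Int.lt_floor_add_one ((σ α).re + (σ α).im)
  have h5 := le_max_left 1 ‖σ α‖
  have h6 := le_max_right 1 ‖σ α‖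
  rw [intHt, Nat.cast_max, Nat.cast_natAbs, Int.cast_abs]
  refine max_le (by norm_num; linarith) (abs_le.2 ⟨?_, ?_⟩) <;> simp only [embVec] <;> linarith

/-- Two elements with the same coordinate vector differ by an element whose conjugates all have
absolute value at most `2`. -/
theorem norm_sub_le_of_embVec_eq {α β : F} (h : embVec α = embVec β) (σ : F →+* ℂ) :
    ‖σ (α - β)‖ ≤ 2 := by
  have key : ∀ τ : F →+* ℂ, |(τ (α - β)).re + (τ (α - β)).im| < 1 := fun τ => by
    have h0 := Int.abs_sub_lt_one_of_floor_eq_floor (congrFun h τ)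
    rwa [add_sub_add_comm, ← Complex.sub_re, ← Complex.sub_im, ← map_sub] at h0
  have h1 := abs_lt.1 (key σ)
  have h2 := abs_lt.1 (key (NumberField.ComplexEmbedding.conjugate σ))
  simp only [NumberField.ComplexEmbedding.conjugate_coe_eq, Complex.conj_re, Complex.conj_im] at h2
  have h3 := Complex.norm_le_abs_re_add_abs_im (σ (α - β))
  have h4 : |(σ (α - β)).re| ≤ 1 := abs_le.2 ⟨by linarith, by linarith⟩
  have h5 : |(σ (α - β)).im| ≤ 1 := abs_le.2 ⟨by linarith, by linarith⟩
  linarith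

variable [NumberField F]

/-- The coordinate map has fibres of uniformly bounded size on algebraic integers. -/
theorem exists_embVec_fiber_bound (F : Type*) [Field F] [NumberField F] :
    ∃ N : ℕ, ∀ S : Finset F, (∀ α ∈ S, IsIntegral ℤ α) →
      S.card ≤ N * Nat.card (embVec '' (S : Set F)) := by
  classical
  have hfin := NumberField.Embeddings.finite_of_norm_le F ℂ 2
  refine ⟨hfin.toFinset.card, fun S hS => ?_⟩
  rw [← Finset.coe_image, Nat.card_coe_set_eq, Set.ncard_coe_finset]
  refine Finset.card_le_mul_card_image S _ fun v hv => ?_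
  obtain ⟨β, hβ, rfl⟩ := Finset.mem_image.1 hv
  refine Finset.card_le_card_of_injOn (fun α => α - β) (fun α hα => ?_)
    (fun a _ b _ hab => sub_left_injective hab)
  obtain ⟨hα1, hα2⟩ := Finset.mem_filter.1 hα
  simp only [Set.Finite.coe_toFinset]
  exact ⟨(hS α hα1).sub (hS β hβ), norm_sub_le_of_embVec_eq hα2⟩

/-- The complex roots of an irreducible polynomial of degree `[F : ℚ]` with a root in `F`
are the distinct conjugates of that root. -/
theorem prod_max_one_norm_le_intMahler {P : ℤ[X]} (hm : P.Monic)
    (hd : P.natDegree = Module.finrank ℚ F) (hirr : Irreducible (P.map (Int.castRingHom ℚ)))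
    {α : F} (hα : aeval α P = 0) : ∏ σ : F →+* ℂ, max 1 ‖σ α‖ ≤ intMahler P := by
  have hmin := map_eq_minpoly hm hirr hα
  have hprim : IntermediateField.adjoin ℚ {α} = ⊤ := by
    rw [Field.primitive_element_iff_minpoly_natDegree_eq, ← hmin, hm.natDegree_map, hd]
  have hinj : Function.Injective fun σ : F →+* ℂ => σ α := by
    have := (Field.primitive_element_iff_algHom_eq_of_eval' ℚ ℂ
      (fun x => IsAlgClosed.splits _) α).1 hprim
    intro σ τ hστ
    have h2 : σ.toRatAlgHom = τ.toRatAlgHom := this hστ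
    ext x
    exact DFunLike.congr_fun h2 x
  have hle : (Finset.univ : Finset (F →+* ℂ)).val.map (fun σ => σ α) ≤
      (P.map (Int.castRingHom ℂ)).roots := by
    rw [Multiset.le_iff_subset (Finset.univ.nodup.map hinj)]
    intro x hx
    obtain ⟨σ, -, rfl⟩ := Multiset.mem_map.1 hx
    rw [mem_roots (hm.map _).ne_zero, IsRoot, eval_map,
      show Int.castRingHom ℂ = σ.comp (algebraMap ℤ F) from RingHom.ext_int _ _, ← hom_eval₂,
      ← aeval_def, hα, map_zero]
  obtain ⟨u, hu⟩ := Multiset.le_iff_exists_add.1 hle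
  rw [intMahler, mahlerMeasure_eq_leadingCoeff_mul_prod_roots, (hm.map _).leadingCoeff, norm_one,
    one_mul, hu, Multiset.map_add, Multiset.prod_add, Multiset.map_map]
  refine le_mul_of_one_le_right (Finset.prod_nonneg fun σ _ => by positivity) ?_
  refine Multiset.one_le_prod fun x hx => ?_
  obtain ⟨y, -, rfl⟩ := Multiset.mem_map.1 hx
  exact le_max_left _ _

/-- The irreducible polynomials of degree `n` with a root in a fixed field `F` of the same degree.
Through the coordinates `embVec` of a root they are mapped, at most `N` to one, into the integer
vectors of a hyperbolic region. -/
theorem ncard_irreducible_le (F : Type*) [Field F] [NumberField F] {n : ℕ}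
    (hn : Module.finrank ℚ F = n) : ∃ C : ℝ, 0 ≤ C ∧ ∀ H : ℕ, 1 ≤ H →
      ((irrFamily F n ∩ polyBox n H).ncard : ℝ) ≤ C * (H * (1 + Real.log H) ^ (n - 1)) := by
  classical
  obtain ⟨m, rfl⟩ : ∃ m, n = m + 1 :=
    Nat.exists_eq_add_one.2 (hn ▸ Module.finrank_pos)
  obtain ⟨N, hN⟩ := exists_embVec_fiber_bound F
  let c : ℕ := 3 ^ (m + 1) * (m + 1 + 1)
  have hc : 1 ≤ c := Nat.succ_le_of_lt (by positivity)
  have hlogc : 0 ≤ Real.log c := Real.log_natCast_nonneg c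
  refine ⟨N * (3 ^ (m + 1) * c * (1 + Real.log c) ^ m), by positivity, fun H hH => ?_⟩
  let e : Fin (m + 1) ≃ (F →+* ℂ) :=
    (Fintype.equivFinOfCardEq (by rw [NumberField.Embeddings.card, hn])).symm
  have hA : (irrFamily F (m + 1) ∩ polyBox (m + 1) H).Finite :=
    (polyBox_finite _ H).inter_of_right _
  -- choose a root of each polynomial; the polynomial is recovered as its minimal polynomial
  have hroot : ∀ P ∈ hA.toFinset, ∃ α : F, aeval α P = 0 := fun P hP =>
    (hA.mem_toFinset.1 hP).1.1.2
  choose! r hr using hroot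
  have hmin : ∀ P ∈ hA.toFinset, P.map (Int.castRingHom ℚ) = minpoly ℚ (r P) := fun P hP => by
    have h1 := hA.mem_toFinset.1 hP
    exact map_eq_minpoly (mem_polyBox_iff.1 h1.2).1 h1.1.2 (hr P hP)
  have hcard : (hA.toFinset.image r).card = hA.toFinset.card := by
    refine Finset.card_image_of_injOn fun P hP Q hQ hPQ => ?_
    refine map_injective _ (Int.castRingHom ℚ).injective_int ?_
    rw [hmin P hP, hmin Q hQ, hPQ]
  have hbound := hN (hA.toFinset.image r) (fun α hα => by
    obtain ⟨P, hP, rfl⟩ := Finset.mem_image.1 hα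
    exact ⟨P, (mem_polyBox_iff.1 (hA.mem_toFinset.1 hP).2).1, hr P hP⟩)
  obtain ⟨hfin, hcount⟩ := hyperbolic_count m (c * H) (Nat.mul_pos hc hH)
  have himage : Nat.card (embVec '' (hA.toFinset.image r : Set F)) ≤
      {z : Fin (m + 1) → ℤ | ∏ i, intHt (z i) ≤ c * H}.ncard := by
    rw [Nat.card_coe_set_eq]
    refine Set.ncard_le_ncard_of_injOn (fun v i => v (e i)) ?_ ?_ hfin
    · rintro _ ⟨α, hα, rfl⟩
      obtain ⟨P, hP, rfl⟩ := Finset.mem_image.1 (Finset.mem_coe.1 hα)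
      have h1 := hA.mem_toFinset.1 hP
      obtain ⟨hPm, hPd, -⟩ := mem_polyBox_iff.1 h1.2
      rw [Set.mem_ofPred_eq, e.prod_comp fun σ => intHt (embVec (r P) σ)]
      have h2 : (∏ σ : F →+* ℂ, (intHt (embVec (r P) σ) : ℝ)) ≤ c * H := by
        calc _ ≤ ∏ σ : F →+* ℂ, (3 * max 1 ‖σ (r P)‖) := by
              gcongr with σ; exact intHt_embVec_le _ σ
          _ = 3 ^ (m + 1) * ∏ σ : F →+* ℂ, max 1 ‖σ (r P)‖ := by
              rw [Finset.prod_mul_distrib, Finset.prod_const, Finset.card_univ,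
                NumberField.Embeddings.card, hn]
          _ ≤ 3 ^ (m + 1) * (((m + 1 : ℕ) + 1) * H) := by
              gcongr
              exact (prod_max_one_norm_le_intMahler hPm (hPd.trans hn.symm) h1.1.2
                (hr P hP)).trans (intMahler_le_of_mem_polyBox hH h1.2)
          _ = _ := by simp only [c]; push_cast; ring
      exact_mod_cast h2
    · intro v _ w _ hvw
      funext σ
      simpa using congrFun hvw (e.symm σ)
  have hlog : 0 ≤ Real.log ((c * H : ℕ) : ℝ) := Real.log_natCast_nonneg _
  calc ((irrFamily F (m + 1) ∩ polyBox (m + 1) H).ncard : ℝ)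
      = (hA.toFinset.image r).card := by rw [hcard, Set.ncard_eq_toFinset_card _ hA]
    _ ≤ N * ({z : Fin (m + 1) → ℤ | ∏ i, intHt (z i) ≤ c * H}.ncard : ℝ) := by
        exact_mod_cast hbound.trans (Nat.mul_le_mul_left N himage)
    _ ≤ N * (3 ^ (m + 1) * ((c * H : ℕ) : ℝ) * (1 + Real.log ((c * H : ℕ) : ℝ)) ^ m) := by
        gcongr
    _ ≤ N * (3 ^ (m + 1) * ((c * H : ℕ) : ℝ) * ((1 + Real.log c) * (1 + Real.log H)) ^ m) := by
        gcongr
        rw [Nat.cast_mul]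
        exact one_add_log_mul_le (by exact_mod_cast hc) (by exact_mod_cast hH)
    _ = _ := by rw [mul_pow]; push_cast; ring

end NumberField

/-- A root of an irreducible polynomial of degree `n` generates one of the finitely many subfields
of `K` of degree `n`. -/
theorem boxCount_irrFamily (K : Type*) [Field K] [NumberField K] (n : ℕ) :
    ∃ C : ℝ, 0 < C ∧ ∀ H : ℕ, 1 ≤ H →
      (boxCount (irrFamily K n) n H : ℝ) ≤ C * (H * (1 + Real.log H) ^ (n - 1)) := by
  classical
  have : Finite (IntermediateField ℚ K) :=
    Field.finite_intermediateField_of_exists_primitive_element ℚ K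
      (Field.exists_primitive_element ℚ K)
  have := Fintype.ofFinite (IntermediateField ℚ K)
  have key : ∀ F : IntermediateField ℚ K, Module.finrank ℚ F = n → ∃ C : ℝ, 0 ≤ C ∧
      ∀ H : ℕ, 1 ≤ H →
        ((irrFamily F n ∩ polyBox n H).ncard : ℝ) ≤ C * (H * (1 + Real.log H) ^ (n - 1)) :=
    fun F hF => ncard_irreducible_le F hF
  choose! C hC0 hC using key
  let I : Finset (IntermediateField ℚ K) := Finset.univ.filter fun F => Module.finrank ℚ F = n
  have hI : ∀ F ∈ I, Module.finrank ℚ F = n := fun F hF => (Finset.mem_filter.1 hF).2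
  have hsum : 0 ≤ ∑ F ∈ I, C F := Finset.sum_nonneg fun F hF => hC0 F (hI F hF)
  refine ⟨∑ F ∈ I, C F + 1, by positivity, fun H hH => ?_⟩
  have hsub : irrFamily K n ∩ polyBox n H ⊆
      ⋃ F ∈ I, (irrFamily (F : IntermediateField ℚ K) n ∩ polyBox n H) := by
    rintro P ⟨⟨⟨hP, α, hα⟩, hirr⟩, hbox⟩
    have hmin := map_eq_minpoly hP.1 hirr hα
    refine Set.mem_biUnion (x := IntermediateField.adjoin ℚ {α}) ?_
      ⟨⟨⟨hP, IntermediateField.AdjoinSimple.gen ℚ α, ?_⟩, hirr⟩, hbox⟩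
    · rw [Finset.mem_coe, Finset.mem_filter]
      refine ⟨Finset.mem_univ _, ?_⟩
      rw [IntermediateField.adjoin.finrank (Algebra.IsIntegral.isIntegral α), ← hmin,
        hP.1.natDegree_map, hP.2]
    · have h1 := aeval_algebraMap_apply K (IntermediateField.AdjoinSimple.gen ℚ α) P
      rw [IntermediateField.AdjoinSimple.algebraMap_gen, hα] at h1
      exact (FaithfulSMul.algebraMap_injective _ K) (by rw [← h1, map_zero])
  have hfin : (⋃ F ∈ I, (irrFamily (F : IntermediateField ℚ K) n ∩ polyBox n H)).Finite :=
    (Finset.finite_toSet _).biUnion fun F _ => (polyBox_finite n H).inter_of_right _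
  have hlog : 0 ≤ Real.log (H : ℝ) := Real.log_natCast_nonneg H
  calc (boxCount (irrFamily K n) n H : ℝ)
      ≤ ∑ F ∈ I, ((irrFamily (F : IntermediateField ℚ K) n ∩ polyBox n H).ncard : ℝ) := by
        exact_mod_cast (Set.ncard_le_ncard hsub hfin).trans (Finset.set_ncard_biUnion_le _ _)
    _ ≤ ∑ F ∈ I, C F * (H * (1 + Real.log H) ^ (n - 1)) :=
        Finset.sum_le_sum fun F hF => hC F (hI F hF) H hH
    _ = (∑ F ∈ I, C F) * (H * (1 + Real.log H) ^ (n - 1)) := by rw [Finset.sum_mul]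
    _ ≤ _ := by gcongr; linarith

/-! ### Comparison of the two parts -/

theorem boxCount_rootFamily_le (K : Type*) [Field K] (n H : ℕ) :
    boxCount (rootFamily K n) n H ≤ boxCount (redFamily K n) n H + boxCount (irrFamily K n) n H := by
  refine (Set.ncard_le_ncard ?_ (((polyBox_finite n H).inter_of_right _).union
    ((polyBox_finite n H).inter_of_right _))).trans (Set.ncard_union_le _ _)
  rintro P ⟨hP, hbox⟩
  by_cases h : Irreducible (P.map (Int.castRingHom ℚ))
  · exact Or.inr ⟨⟨hP, h⟩, hbox⟩
  · exact Or.inl ⟨⟨hP, h⟩, hbox⟩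

theorem one_add_log_le {H : ℕ} (hH : 2 ≤ H) : 1 + Real.log H ≤ 3 * Real.log H := by
  have h : Real.log 2 ≤ Real.log H := Real.log_le_log (by norm_num) (by exact_mod_cast hH)
  linarith [Real.log_two_gt_d9]

theorem boxDensity_le_of_boxCount_le {S : Set ℤ[X]} {n H : ℕ} (hn : 1 ≤ n) (hH : 1 ≤ H) {B : ℝ}
    (hB : 0 ≤ B) (h : (boxCount S n H : ℝ) ≤ B * H ^ (n - 1)) :
    boxDensity S n H ≤ B * (H : ℝ)⁻¹ := by
  have hH0 : (0 : ℝ) < H := by exact_mod_cast hH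
  rw [boxDensity, ncard_polyBox, div_le_iff₀ (by positivity)]
  obtain ⟨m, rfl⟩ := Nat.exists_eq_add_of_le' hn
  calc _ ≤ _ := h
    _ = B * (H : ℝ)⁻¹ * (H : ℝ) ^ (m + 1) := by
        rw [Nat.add_sub_cancel, pow_succ]; field_simp
    _ ≤ _ := by
        gcongr
        exact_mod_cast Nat.pow_le_pow_left (by omega : H ≤ 2 * H + 1) _

theorem tendsto_inv_mul_log :
    Filter.Tendsto (fun H : ℕ => (H : ℝ)⁻¹ * Real.log H) Filter.atTop (nhds 0) := by
  have h := Real.isLittleO_log_id_atTop.tendsto_div_nhds_zero.comp tendsto_natCast_atTop_atTop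
  refine h.congr fun H => ?_
  simp [div_eq_inv_mul]

theorem boxDensity_nonneg (S : Set ℤ[X]) (n H : ℕ) : 0 ≤ boxDensity S n H := by
  unfold boxDensity; positivity

theorem mainTheorem2 (K : Type*) [Field K] [NumberField K] (n : ℕ) (hn : 2 ≤ n) :
    -- the density tends to zero, with the stated rates
    Filter.Tendsto (fun H : ℕ => boxDensity (rootFamily K n) n H) Filter.atTop (nhds 0) ∧
    (n = 2 → ∃ C : ℝ, 0 < C ∧ ∀ H : ℕ, 2 ≤ H →
      boxDensity (rootFamily K n) n H ≤ C * ((H : ℝ)⁻¹ * Real.log H)) ∧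
    (3 ≤ n → ∃ C : ℝ, 0 < C ∧ ∀ H : ℕ, 1 ≤ H →
      boxDensity (rootFamily K n) n H ≤ C * (H : ℝ)⁻¹) ∧
    -- the reducible part
    (n = 2 → ∃ C : ℝ, 0 < C ∧ ∀ H : ℕ, 2 ≤ H →
      (boxCount (redFamily K n) n H : ℝ) ≤ C * ((H : ℝ) * Real.log H)) ∧
    (3 ≤ n → ∃ C : ℝ, 0 < C ∧ ∀ H : ℕ, 1 ≤ H →
      (boxCount (redFamily K n) n H : ℝ) ≤ C * (H : ℝ) ^ (n - 1)) ∧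
    -- the irreducible part
    (∃ C : ℝ, 0 < C ∧ ∀ H : ℕ, 2 ≤ H →
      (boxCount (irrFamily K n) n H : ℝ) ≤ C * ((H : ℝ) * Real.log H ^ (n - 1))) ∧
    -- for `n ≥ 3` the irreducible part is negligible compared to the reducible part
    (3 ≤ n →
      (fun H : ℕ => (boxCount (irrFamily K n) n H : ℝ)) =o[Filter.atTop]
        (fun H : ℕ => (boxCount (redFamily K n) n H : ℝ))) := by
  have hpos : ∀ H : ℕ, 0 ≤ Real.log (H : ℝ) := fun H => Real.log_natCast_nonneg H
  have hroot : ∀ H : ℕ, (boxCount (rootFamily K n) n H : ℝ) ≤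
      boxCount (redFamily K n) n H + boxCount (irrFamily K n) n H := fun H => by
    exact_mod_cast boxCount_rootFamily_le K n H
  obtain ⟨C₁, hC₁, hirr⟩ := boxCount_irrFamily K n
  have irr : ∃ C : ℝ, 0 < C ∧ ∀ H : ℕ, 2 ≤ H →
      (boxCount (irrFamily K n) n H : ℝ) ≤ C * ((H : ℝ) * Real.log H ^ (n - 1)) := by
    refine ⟨C₁ * 3 ^ (n - 1), by positivity, fun H hH => (hirr H (by omega)).trans ?_⟩
    have := hpos H
    calc _ ≤ C₁ * (H * (3 * Real.log H) ^ (n - 1)) := by gcongr; exact one_add_log_le hH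
      _ = _ := by rw [mul_pow]; ring
  have red2 : n = 2 → ∃ C : ℝ, 0 < C ∧ ∀ H : ℕ, 2 ≤ H →
      (boxCount (redFamily K n) n H : ℝ) ≤ C * ((H : ℝ) * Real.log H) := by
    rintro rfl
    obtain ⟨C, hC, h⟩ := boxCount_redFamily_two K
    refine ⟨C * 3, by positivity, fun H hH => (h H (by omega)).trans ?_⟩
    calc _ ≤ C * (H * (3 * Real.log H)) := by gcongr; exact one_add_log_le hH
      _ = _ := by ring
  have dens2 : n = 2 → ∃ C : ℝ, 0 < C ∧ ∀ H : ℕ, 2 ≤ H →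
      boxDensity (rootFamily K n) n H ≤ C * ((H : ℝ)⁻¹ * Real.log H) := by
    intro h2
    obtain ⟨C, hC, h⟩ := red2 h2
    obtain ⟨C', hC', h'⟩ := irr
    subst h2
    refine ⟨C + C', by positivity, fun H hH => ?_⟩
    have := hpos H
    rw [mul_comm (H : ℝ)⁻¹, ← mul_assoc]
    refine boxDensity_le_of_boxCount_le (by omega) (by omega) (by positivity) ?_
    have h3 := h H hH
    have h4 := h' H hH
    have h5 := hroot H
    simp only [show 2 - 1 = 1 from rfl, pow_one] at h4 ⊢
    linarith
  have dens3 : 3 ≤ n → ∃ C : ℝ, 0 < C ∧ ∀ H : ℕ, 1 ≤ H →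
      boxDensity (rootFamily K n) n H ≤ C * (H : ℝ)⁻¹ := by
    intro h3
    obtain ⟨C, hC, h⟩ := boxCount_redFamily_of_three_le K h3
    refine ⟨C + C₁ * ((n - 1).factorial * Real.exp 1), by positivity, fun H hH => ?_⟩
    refine boxDensity_le_of_boxCount_le (by omega) hH (by positivity) ?_
    have hH1 : (1 : ℝ) ≤ H := by exact_mod_cast hH
    have h4 : (boxCount (irrFamily K n) n H : ℝ) ≤
        C₁ * ((n - 1).factorial * Real.exp 1) * (H : ℝ) ^ (n - 1) := by
      calc _ ≤ _ := hirr H hH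
        _ ≤ C₁ * (H * ((n - 1).factorial * Real.exp 1 * H)) := by
            gcongr; exact one_add_log_pow_le _ hH1
        _ = C₁ * ((n - 1).factorial * Real.exp 1) * (H : ℝ) ^ 2 := by ring
        _ ≤ _ := by
            gcongr
            omega
    have h5 := h H hH
    have h6 := hroot H
    linarith
  have lim : Filter.Tendsto (fun H : ℕ => boxDensity (rootFamily K n) n H) Filter.atTop
      (nhds 0) := by
    rcases hn.eq_or_lt with h2 | h3
    · obtain ⟨C, -, h⟩ := dens2 h2.symm
      refine squeeze_zero' (Filter.Eventually.of_forall fun H => boxDensity_nonneg _ _ _)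
        (Filter.eventually_atTop.2 ⟨2, h⟩) ?_
      simpa using tendsto_inv_mul_log.const_mul C
    · obtain ⟨C, -, h⟩ := dens3 h3
      refine squeeze_zero' (Filter.Eventually.of_forall fun H => boxDensity_nonneg _ _ _)
        (Filter.eventually_atTop.2 ⟨1, h⟩) ?_
      simpa using tendsto_inv_atTop_nhds_zero_nat.const_mul C
  refine ⟨lim, dens2, dens3, red2, boxCount_redFamily_of_three_le K, irr, fun h3 => ?_⟩
  obtain ⟨C, hC, h⟩ := irr
  have h1 : (fun H : ℕ => (boxCount (irrFamily K n) n H : ℝ)) =O[Filter.atTop]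
      fun H : ℕ => (H : ℝ) * Real.log H ^ (n - 1) := by
    refine Asymptotics.IsBigO.of_bound C (Filter.eventually_atTop.2 ⟨2, fun H hH => ?_⟩)
    have := hpos H
    rw [Real.norm_of_nonneg (by positivity), Real.norm_of_nonneg (by positivity)]
    exact h H hH
  have h2 : (fun H : ℕ => (H : ℝ) * Real.log H ^ (n - 1)) =o[Filter.atTop]
      fun H : ℕ => (H : ℝ) * H :=
    (Asymptotics.isBigO_refl _ _).mul_isLittleO
      ((Real.isLittleO_pow_log_id_atTop (n := n - 1)).comp_tendsto tendsto_natCast_atTop_atTop)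
  have h4 : (fun H : ℕ => (H : ℝ) * H) =O[Filter.atTop]
      fun H : ℕ => (boxCount (redFamily K n) n H : ℝ) := by
    refine Asymptotics.IsBigO.of_bound 1 (Filter.eventually_atTop.2 ⟨1, fun H hH => ?_⟩)
    rw [Real.norm_of_nonneg (by positivity), Real.norm_of_nonneg (by positivity), one_mul]
    have h5 : H * H ≤ boxCount (redFamily K n) n H :=
      calc H * H ≤ (2 * H + 1) ^ 2 := by nlinarith
        _ ≤ (2 * H + 1) ^ (n - 1) := Nat.pow_le_pow_right (by omega) (by omega)
        _ ≤ _ := le_boxCount_redFamily K hn H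
    exact_mod_cast h5
  exact (h1.trans_isLittleO h2).trans_isBigO h4
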